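/- Let $K$ be a field and let $p\ge 1$. A $1$-Ferrer partition is an integer $\lambda\ge 1$; for $p\ge 2$ a $p$-Ferrer partition is a finite nonempty sequence $\Phi:\lambda_1\ge\lambda_2\ge\dots\ge\lambda_m$ of $(p-1)$-Ferrer partitions, where for $1$-Ferrer partitions $\ge$ is the order of the integers and, for $q\ge 2$, two $q$-Ferrer partitions $\lambda:\lambda_1\ge\dots\ge\lambda_s$ and $\mu:\mu_1\ge\dots\ge\mu_{s'}$ satisfy $\lambda\ge\mu$ if and only if $s\ge s'$ and $\lambda_j\ge\mu_j$ for $j=1,\dots,s'$. Let $R$ be a polynomial ring over $K$, standard graded, that contains among its variables the pairwise distinct variables $x^{(q)}_j$ used below. The ideal $\mathcal I_\Phi\subset R$ is $(x^{(1)}_1,\dots,x^{(1)}_\lambda)$ if $p=1$ and $\Phi=\lambda$, and for $p\ge 2$ it is generated by the products $x^{(p)}_i y$ with $1\le i\le m$ and $y\in\mathcal I_{\lambda_i}$. The ideals of the form $\mathcal I_\Phi$ are called $p$-Ferrer ideals. For a graded $R$-module $M$ with minimal graded free resolution $\cdots\to F_1\to F_0\to M\to 0$, the Castelnuovo–Mumford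 regularity $\operatorname{reg}(M)$ is the supremum of $j-i$ over all $i,j$ such that $F_i$ has a minimal generator of degree $j$. **Proposition.** Let $\mathcal I\subset R$ be a $p$-Ferrer ideal. Then $\operatorname{reg}(\mathcal I)=p=\operatorname{reg}(R/\mathcal I)+1$. Moreover $\mathcal I$ has a $p$-linear resolution: in its minimal graded free resolution $\cdots\to F_1\to F_0\to\mathcal I\to 0$, each $F_i$ is generated in degree $p+i$. -/

import Mathlib

open MvPolynomial

/-! ### Ferrer partitions -/

/-- Arrays underlying `p`-Ferrer partitions: for `p = 1` a natural number, and for larger `p` a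
finite sequence `lam 0, ..., lam (m - 1)` of arrays of dimension `p - 1`.
There are none for `p = 0`. -/
def FerrerArray : ℕ → Type
  | 0 => Empty
  | 1 => ℕ
  | p + 2 => Σ m : ℕ, (Fin m → FerrerArray (p + 1))

namespace FerrerArray

/-- The recursive comparison `a ≤ b`: `a` is at most as long as `b`, and each entry of `a` is
`≤` the entry of `b` at the same place. -/
def Le : (p : ℕ) → FerrerArray p → FerrerArray p → Prop
  | 0, _, _ => True
  | 1, a, b => Nat.le a b
  | p + 2, a, b => ∃ h : a.1 ≤ b.1, ∀ j : Fin a.1, Le (p + 1) (a.2 j) (b.2 (Fin.castLE h j))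

/-- `p`-Ferrer partitions: a nonzero natural number for `p = 1`; for larger `p`, a nonempty
decreasing sequence of `(p - 1)`-Ferrer partitions. -/
def IsPartition : (p : ℕ) → FerrerArray p → Prop
  | 0, _ => False
  | 1, l => Nat.lt 0 l
  | p + 2, a => 0 < a.1 ∧ (∀ i, IsPartition (p + 1) (a.2 i)) ∧
      ∀ i j, i ≤ j → Le (p + 1) (a.2 j) (a.2 i)

/-- The pairs `(q, j)` such that the variable `x_j^{(q)}` is used by the array. -/
def vars : (p : ℕ) → FerrerArray p → Set (ℕ × ℕ)
  | 0, _ => ∅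
  | 1, l => {v | v.1 = 1 ∧ 1 ≤ v.2 ∧ Nat.le v.2 l}
  | p + 2, a => {v | v.1 = p + 2 ∧ 1 ≤ v.2 ∧ v.2 ≤ a.1} ∪ ⋃ i, vars (p + 1) (a.2 i)

/-- The ideal of an array, where `x (q, j)` is the variable `x_j^{(q)}`: for `p = 1` it is
generated by `x_1^{(1)}, ..., x_l^{(1)}`, and for larger `p` by the products `x_i^{(p)} y` with
`y` in the ideal of the `i`-th entry. (Entries are numbered from `0` in `Fin m`, variables
from `1`.) -/
noncomputable def ideal (K : Type*) [Field K] {σ : Type*} (x : ℕ × ℕ → σ) :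
    (p : ℕ) → FerrerArray p → Ideal (MvPolynomial σ K)
  | 0, _ => ⊥
  | 1, l => Ideal.span {f | ∃ j : ℕ, 1 ≤ j ∧ Nat.le j l ∧ f = X (x (1, j))}
  | p + 2, a => Ideal.span {f | ∃ i : Fin a.1, ∃ y ∈ ideal K x (p + 1) (a.2 i),
      f = X (x (p + 2, (i : ℕ) + 1)) * y}

end FerrerArray

/-- An ideal of a polynomial ring is a `p`-Ferrer ideal if it is the ideal of some `p`-Ferrer
partition `Φ`, formed with pairwise distinct variables `x_j^{(q)}` of the ring. -/
def IsFerrerIdeal {K σ : Type*} [Field K] (p : ℕ) (I : Ideal (MvPolynomial σ K)) : Prop :=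
  ∃ Φ : FerrerArray p, FerrerArray.IsPartition p Φ ∧
    ∃ x : ℕ × ℕ → σ, Set.InjOn x (FerrerArray.vars p Φ) ∧ I = FerrerArray.ideal K x p Φ

/-! ### Graded modules over a polynomial ring and their graded free resolutions -/

/-- The grading of an ideal induced by the standard grading of the polynomial ring. -/
noncomputable def idealGrading {K σ : Type*} [Field K] (I : Ideal (MvPolynomial σ K)) (n : ℕ) :
    Submodule K I :=
  (homogeneousSubmodule σ K n).comap (I.subtype.restrictScalars K)

/-- The grading of a quotient `R ⧸ I` induced by the standard grading of the polynomial ring. -/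
noncomputable def quotientGrading {K σ : Type*} [Field K] (I : Ideal (MvPolynomial σ K)) (n : ℕ) :
    Submodule K (MvPolynomial σ K ⧸ I) :=
  (homogeneousSubmodule σ K n).map (Ideal.Quotient.mkₐ K I).toLinearMap

section Resolution

variable {K σ M : Type*} [Field K] [AddCommGroup M] [Module K M] [Module (MvPolynomial σ K) M]

/-- Graded free resolutions `... → F₁ → F₀ → M → 0` of a module `M` over `R = MvPolynomial σ K`
with graded pieces `ℳ n`. Here `F i` is free with basis `e_a`, `a : Fin (rank i)`, and `e_a` has
degree `deg i a`, that is `F i = ⨁ₐ R(-deg i a)`; all maps preserve degrees. -/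
structure GradedFreeResolution (ℳ : ℕ → Submodule K M) where
  rank : ℕ → ℕ
  deg : (i : ℕ) → Fin (rank i) → ℕ
  d : (i : ℕ) → (Fin (rank (i + 1)) → MvPolynomial σ K) →ₗ[MvPolynomial σ K]
    (Fin (rank i) → MvPolynomial σ K)
  ε : (Fin (rank 0) → MvPolynomial σ K) →ₗ[MvPolynomial σ K] M
  /-- The `(b, a)` matrix entry of `d i` is homogeneous of degree `deg (i + 1) a - deg i b`
  (hence zero if this is negative). -/
  d_homogeneous : ∀ i a b, ∀ m ∈ (d i (Pi.single a 1) b).support,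
    m.degree + deg i b = deg (i + 1) a
  ε_homogeneous : ∀ a, ε (Pi.single a 1) ∈ ℳ (deg 0 a)
  ε_surjective : Function.Surjective ε
  exact_zero : Function.Exact (d 0) ε
  exact_succ : ∀ i, Function.Exact (d (i + 1)) (d i)

variable (ℳ : ℕ → Submodule K M)

/-- A graded free resolution is minimal if all matrix entries of its differentials lie in the
ideal generated by the variables. -/
def GradedFreeResolution.IsMinimal {ℳ : ℕ → Submodule K M}
    (F : GradedFreeResolution (σ := σ) ℳ) : Prop :=
  ∀ i a b, constantCoeff (F.d i (Pi.single a 1) b) = 0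

variable (σ) in
/-- Castelnuovo–Mumford regularity: the supremum of `j - i` over all `i, j` such that the `i`-th
module of the minimal graded free resolution has a generator of degree `j`. (The minimal
graded free resolution is unique up to isomorphism. The value is `⊥` if there is none, or if
the module is zero.) -/
noncomputable def castelnuovoMumfordRegularity : EReal :=
  sSup {r : EReal | ∃ F : GradedFreeResolution (σ := σ) ℳ, F.IsMinimal ∧
    ∃ (i : ℕ) (a : Fin (F.rank i)), r = (((F.deg i a : ℝ) - (i : ℝ) : ℝ) : EReal)}

variable (σ) in
/-- The minimal graded free resolution is `p`-linear: the `i`-th free module is generated in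
degree `p + i`, so the generators have degree `p` and the matrices have linear entries. -/
def HasLinearResolution (p : ℕ) : Prop :=
  ∃ F : GradedFreeResolution (σ := σ) ℳ, F.IsMinimal ∧
    ∀ (i : ℕ) (a : Fin (F.rank i)), F.deg i a = p + i

end Resolution

/-! ### Homogeneous components of linear combinations. -/

section HomogeneousVectors

variable {K σ : Type*} [Field K]

/-! The ideal of a Ferrer partition is generated by monomials of degree `p`, and these have linear
quotients. List them row by row according to the factor `x_i` of top level, each row in an
inductively given order. Compare a new generator `x_k u` with an earlier `x_i t`, `i < k`. The
variable `x_i` does not divide `x_k u`. Since the rows decrease, `u` also belongs to row `i`, so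
`x_i u` is an earlier generator and `x_i` lies in the colon ideal. Hence all colon ideals are
generated by variables (`FerrerArray.hasLinearQuotients_exponents`).

If `u` is a form of the same degree as the generators of `I`, the syzygies of `I + (u)` are an
extension of the colon ideal `I : u` by the syzygies of `I`. The horseshoe lemma
(`HasLinearSyzygies.extension`) carries linearity through extensions, so adding generators one by
one keeps the syzygies linear. Ideals of variables are handled in the same way.

Regularity is a supremum over all minimal resolutions, so their degrees must also be unique. Free
modules of two minimal presentations, one of them in a single degree, are related by an invertible
scalar matrix (`GradedFreeResolution.exists_comparison`); removing the first step and iterating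
gives `HasLinearSyzygies.deg_eq`. The presentation of `R/I` by `R` has `I` as relation module,
whence the regularity `p - 1`. -/

theorem homogeneousComponent_mul_isHomogeneous (f : MvPolynomial σ K) {v : MvPolynomial σ K}
    {s : ℕ} (hv : v.IsHomogeneous s) (n : ℕ) :
    homogeneousComponent n (f * v) =
      if s ≤ n then homogeneousComponent (n - s) f * v else 0 := by
  let _ := MvPolynomial.gradedAlgebra (σ := σ) (R := K)
  have h := DirectSum.coe_decompose_mul_of_right_mem (𝒜 := homogeneousSubmodule σ K) (a := f) n
    ((mem_homogeneousSubmodule s v).2 hv)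
  have e : ∀ (g : MvPolynomial σ K) (k : ℕ),
      ((DirectSum.decompose (homogeneousSubmodule σ K) g) k : MvPolynomial σ K) =
        homogeneousComponent k g := fun g k => decomposition.decompose'_apply g k
  simpa only [e] using h

theorem homogeneousComponent_linearCombination {κ ι : Type*} [Fintype κ]
    {v : κ → ι → MvPolynomial σ K} {s : ℕ} (hv : ∀ a b, (v a b).IsHomogeneous s)
    (p : κ → MvPolynomial σ K) (n : ℕ) (b : ι) :
    homogeneousComponent n (Fintype.linearCombination (MvPolynomial σ K) v p b) =
      if s ≤ n then Fintype.linearCombination (MvPolynomial σ K) v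
        (fun a => homogeneousComponent (n - s) (p a)) b else 0 := by
  simp only [Fintype.linearCombination_apply, Finset.sum_apply, Pi.smul_apply, smul_eq_mul,
    map_sum, homogeneousComponent_mul_isHomogeneous _ (hv _ b)]
  split_ifs <;> simp

theorem isHomogeneous_of_forall_degree_add_eq {f : MvPolynomial σ K} {d n : ℕ}
    (h : ∀ m ∈ f.support, m.degree + d = n) : f.IsHomogeneous (n - d) := by
  intro m hm
  have := h m (mem_support_iff.2 hm)
  rw [Finsupp.degree_eq_weight_one] at this
  simp only [Pi.one_def] at this ⊢
  omega

theorem degree_eq_of_isHomogeneous {f : MvPolynomial σ K} {n : ℕ} (h : f.IsHomogeneous n)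
    {m : σ →₀ ℕ} (hm : m ∈ f.support) : m.degree = n := by
  by_contra hne
  exact mem_support_iff.1 hm (h.coeff_eq_zero hne)

/-- A linear combination of vectors of degree `s` that is homogeneous has homogeneous
coefficients. -/
theorem exists_homogeneous_coefficients {κ ι : Type*} [Fintype κ]
    {v : κ → ι → MvPolynomial σ K} {s : ℕ} (hv : ∀ a b, (v a b).IsHomogeneous s)
    (p : κ → MvPolynomial σ K) {d n : ℕ}
    (h : ∀ b, ∀ m ∈ (Fintype.linearCombination (MvPolynomial σ K) v p b).support,
      m.degree + d = n) :
    ∃ q : κ → MvPolynomial σ K, (∀ a, ∀ m ∈ (q a).support, m.degree + (d + s) = n) ∧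
      Fintype.linearCombination (MvPolynomial σ K) v q =
        Fintype.linearCombination (MvPolynomial σ K) v p := by
  have key : ∀ b, Fintype.linearCombination (MvPolynomial σ K) v p b =
      homogeneousComponent (n - d) (Fintype.linearCombination (MvPolynomial σ K) v p b) :=
    fun b => (homogeneousComponent_eq_self
      ((mem_homogeneousSubmodule _ _).2 (isHomogeneous_of_forall_degree_add_eq (h b)))).symm
  by_cases hn : d + s ≤ n
  · refine ⟨fun a => homogeneousComponent (n - d - s) (p a), fun a m hm => ?_, ?_⟩
    · have := degree_eq_of_isHomogeneous (homogeneousComponent_isHomogeneous _ _) hm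
      omega
    · funext b
      rw [key b, homogeneousComponent_linearCombination hv, if_pos (by omega)]
  -- For `n < d + s` the combination itself vanishes: its degree would be below `s`, or negative
  -- when `n < d`.
  · refine ⟨0, by simp, ?_⟩
    rw [map_zero]
    funext b
    by_cases hd : d ≤ n
    · rw [key b, homogeneousComponent_linearCombination hv, if_neg (by omega), Pi.zero_apply]
    · symm
      rw [Pi.zero_apply, ← support_eq_empty, Finset.eq_empty_iff_forall_notMem]
      intro m hm
      have := h b m hm
      omega

/-- A vector in the kernel of a matrix whose entries are all of degree `s` has its homogeneous
components in the kernel. -/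
theorem homogeneousComponent_mem_ker {κ ι : Type*} [Fintype κ]
    {v : κ → ι → MvPolynomial σ K} {s : ℕ} (hv : ∀ a b, (v a b).IsHomogeneous s)
    {p : κ → MvPolynomial σ K}
    (hp : p ∈ LinearMap.ker (Fintype.linearCombination (MvPolynomial σ K) v)) (n : ℕ) :
    (fun a => homogeneousComponent n (p a)) ∈
      LinearMap.ker (Fintype.linearCombination (MvPolynomial σ K) v) := by
  rw [LinearMap.mem_ker] at hp ⊢
  funext b
  have h := homogeneousComponent_linearCombination hv p (n + s) b
  rw [hp, if_pos (by omega), Nat.add_sub_cancel] at h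
  simpa using h.symm

end HomogeneousVectors

/-! ### Linear syzygies and the horseshoe lemma. -/

section LinearSyzygies

variable {K σ : Type*} [Field K]

/-- `HasLinearSyzygies n N s`: the submodule `N` of a free module is generated by vectors with
homogeneous entries of degree `s`, all its iterated syzygies are generated by vectors with
linear entries, and the `n`-th one vanishes. -/
def HasLinearSyzygies : ℕ → ∀ {ι : Type}, Submodule (MvPolynomial σ K) (ι → MvPolynomial σ K) →
    ℕ → Prop
  | 0, _, N, _ => N = ⊥
  | n + 1, ι, N, s => ∃ (r : ℕ) (v : Fin r → ι → MvPolynomial σ K),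
      (∀ a b, (v a b).IsHomogeneous s) ∧
      N = LinearMap.range (Fintype.linearCombination (MvPolynomial σ K) v) ∧
      HasLinearSyzygies n (LinearMap.ker (Fintype.linearCombination (MvPolynomial σ K) v)) 1

/-- The number `n` only bounds the length, since the zero module has an empty generating family.
This provides generators even when `n = 0`. -/
theorem HasLinearSyzygies.succ {n : ℕ} : ∀ {ι : Type}
    {N : Submodule (MvPolynomial σ K) (ι → MvPolynomial σ K)} {s : ℕ},
    HasLinearSyzygies n N s → HasLinearSyzygies (n + 1) N s := by
  induction n with
  | zero =>
    rintro ι N s rfl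
    refine ⟨0, Fin.elim0, fun a => a.elim0, ?_, ?_⟩
    · rw [eq_comm, LinearMap.range_eq_bot]
      exact Subsingleton.elim _ _
    · exact Subsingleton.elim _ _
  | succ n ih =>
    rintro ι N s ⟨r, v, hv, hN, h⟩
    exact ⟨r, v, hv, hN, ih h⟩

theorem HasLinearSyzygies.mono {n k : ℕ} (hnk : n ≤ k) {ι : Type}
    {N : Submodule (MvPolynomial σ K) (ι → MvPolynomial σ K)} {s : ℕ}
    (h : HasLinearSyzygies n N s) : HasLinearSyzygies k N s := by
  induction k, hnk using Nat.le_induction with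
  | base => exact h
  | succ k _ ih => exact ih.succ

theorem linearCombination_sumElim {ι : Type*} {r t : ℕ}
    (w : Fin r ⊕ Fin t → ι → MvPolynomial σ K)
    (a : Fin r → MvPolynomial σ K) (c : Fin t → MvPolynomial σ K) :
    Fintype.linearCombination (MvPolynomial σ K) (w ∘ finSumFinEquiv.symm)
      (Sum.elim a c ∘ finSumFinEquiv.symm) =
    Fintype.linearCombination (MvPolynomial σ K) (w ∘ Sum.inl) a +
      Fintype.linearCombination (MvPolynomial σ K) (w ∘ Sum.inr) c := by
  simp only [Fintype.linearCombination_apply, Function.comp_apply]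
  rw [← Equiv.sum_comp finSumFinEquiv]
  simp [Fintype.sum_sum_type]

theorem sumElim_comp_equiv {α β γ M : Type*} (e : β ≃ α ⊕ γ) (b : β → M) :
    Sum.elim (b ∘ e.symm ∘ Sum.inl) (b ∘ e.symm ∘ Sum.inr) ∘ e = b := by
  funext i
  obtain ⟨x, rfl⟩ := e.symm.surjective i
  rcases x with x | x <;> simp

/-- The horseshoe lemma: `B` is an extension of `C` by `A`. -/
theorem HasLinearSyzygies.extension {n : ℕ} : ∀ {α β γ : Type} {s : ℕ} (e : β ≃ α ⊕ γ)
    {A : Submodule (MvPolynomial σ K) (α → MvPolynomial σ K)}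
    {B : Submodule (MvPolynomial σ K) (β → MvPolynomial σ K)}
    {C : Submodule (MvPolynomial σ K) (γ → MvPolynomial σ K)}
    (_ : ∀ a, a ∈ A ↔ Sum.elim a 0 ∘ e ∈ B)
    (_ : ∀ c, c ∈ C ↔ ∃ a, Sum.elim a c ∘ e ∈ B)
    (_ : ∀ b ∈ B, ∀ k, (fun i => homogeneousComponent k (b i)) ∈ B)
    (_ : HasLinearSyzygies n A s) (_ : HasLinearSyzygies n C s), HasLinearSyzygies n B s := by
  induction n with
  | zero =>
    rintro α β γ s e _ B _ hA hC - rfl rfl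
    refine (Submodule.eq_bot_iff _).2 fun b hb => ?_
    have hb' := (sumElim_comp_equiv e b).symm
    have hc : b ∘ e.symm ∘ Sum.inr = 0 := (hC _).2 ⟨b ∘ e.symm ∘ Sum.inl, hb' ▸ hb⟩
    rw [hc] at hb'
    have ha : b ∘ e.symm ∘ Sum.inl = 0 := (hA _).2 (hb' ▸ hb)
    rw [hb', ha]
    funext i
    rcases e i with x | x <;> simp
  | succ n ih =>
    rintro α β γ s e A B C hA hC hB ⟨r, v, hv, hAv, hKv⟩ ⟨t, w, hw, hCw, hKw⟩
    have hlift : ∀ l, ∃ u : α → MvPolynomial σ K, Sum.elim u (w l) ∘ e ∈ B ∧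
        ∀ i, (u i).IsHomogeneous s := by
      intro l
      have hl : w l ∈ C := by
        rw [hCw]
        exact ⟨Pi.single l 1, by simp⟩
      obtain ⟨u, hu⟩ := (hC _).1 hl
      -- Truncating the lift to degree `s` stays in the graded module `B` and leaves `w l`
      -- unchanged, since it already has degree `s`.
      refine ⟨fun i => homogeneousComponent s (u i), ?_,
        fun i => homogeneousComponent_isHomogeneous _ _⟩
      convert hB _ hu s using 1
      funext i
      rcases h : e i with x | x
      · simp [h]
      · simp [h, homogeneousComponent_eq_self ((mem_homogeneousSubmodule _ _).2 (hw l x))]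
    choose u huB hus using hlift
    let z : Fin r ⊕ Fin t → β → MvPolynomial σ K :=
      Sum.elim (fun k => Sum.elim (v k) 0 ∘ e) (fun l => Sum.elim (u l) (w l) ∘ e)
    have hz : ∀ a c, Fintype.linearCombination (MvPolynomial σ K) (z ∘ finSumFinEquiv.symm)
        (Sum.elim a c ∘ finSumFinEquiv.symm) =
        Sum.elim (Fintype.linearCombination (MvPolynomial σ K) v a +
          Fintype.linearCombination (MvPolynomial σ K) u c)
          (Fintype.linearCombination (MvPolynomial σ K) w c) ∘ e := by
      intro a c
      rw [linearCombination_sumElim]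
      funext i
      rcases h : e i with x | x <;>
        simp [z, h, Fintype.linearCombination_apply, Finset.sum_apply]
    have hzhom : ∀ a b, ((z ∘ finSumFinEquiv.symm) a b).IsHomogeneous s := by
      intro a b
      rcases h : finSumFinEquiv.symm a with k | k <;> rcases h' : e b with x | x
      · simpa [z, h, h'] using hv k x
      · simpa [z, h, h'] using isHomogeneous_zero σ K s
      · simpa [z, h, h'] using hus k x
      · simpa [z, h, h'] using hw k x
    have hzB : ∀ c, Sum.elim (Fintype.linearCombination (MvPolynomial σ K) u c)
        (Fintype.linearCombination (MvPolynomial σ K) w c) ∘ e ∈ B := by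
      intro c
      have : Sum.elim (Fintype.linearCombination (MvPolynomial σ K) u c)
          (Fintype.linearCombination (MvPolynomial σ K) w c) ∘ e =
          ∑ l, c l • (Sum.elim (u l) (w l) ∘ e) := by
        funext i
        rcases h : e i with x | x <;>
          simp [h, Fintype.linearCombination_apply, Finset.sum_apply]
      rw [this]
      exact B.sum_mem fun l _ => B.smul_mem _ (huB l)
    have hadd : ∀ (a a' : α → MvPolynomial σ K) (c : γ → MvPolynomial σ K),
        Sum.elim (a + a') c ∘ e = Sum.elim a 0 ∘ e + Sum.elim a' c ∘ e := by
      intro a a' c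
      funext i
      rcases h : e i with x | x <;> simp [h]
    have hmem : ∀ a a' c, Sum.elim a' c ∘ e ∈ B → (Sum.elim (a + a') c ∘ e ∈ B ↔ a ∈ A) := by
      intro a a' c h
      rw [hadd, B.add_mem_iff_left h, hA]
    refine ⟨r + t, z ∘ finSumFinEquiv.symm, hzhom, ?_, ?_⟩
    · ext b
      constructor
      · intro hb
        rw [← sumElim_comp_equiv e b] at hb
        obtain ⟨c, hc⟩ : b ∘ e.symm ∘ Sum.inr ∈
            LinearMap.range (Fintype.linearCombination (MvPolynomial σ K) w) :=
          hCw ▸ (hC _).2 ⟨_, hb⟩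
        rw [← hc, ← sub_add_cancel (b ∘ e.symm ∘ Sum.inl)
          (Fintype.linearCombination (MvPolynomial σ K) u c), hmem _ _ _ (hzB c), hAv] at hb
        obtain ⟨a, ha⟩ := hb
        refine ⟨Sum.elim a c ∘ finSumFinEquiv.symm, ?_⟩
        rw [hz, ha, hc, sub_add_cancel, sumElim_comp_equiv]
      · rintro ⟨q, rfl⟩
        rw [← sumElim_comp_equiv finSumFinEquiv.symm q, hz, hmem _ _ _ (hzB _), hAv]
        exact ⟨_, rfl⟩
    · have hzero : ∀ (a : α → MvPolynomial σ K) (c : γ → MvPolynomial σ K),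
          Sum.elim a c ∘ e = 0 ↔ a = 0 ∧ c = 0 := by
        intro a c
        constructor
        · intro h
          constructor
          · funext x
            simpa using congrFun h (e.symm (Sum.inl x))
          · funext x
            simpa using congrFun h (e.symm (Sum.inr x))
        · rintro ⟨rfl, rfl⟩
          funext i
          rcases e i with x | x <;> simp
      -- The matrix `z` is block triangular, so its kernel is an extension of the kernel of `w` by
      -- that of `v`.
      refine ih finSumFinEquiv.symm ?_ ?_
        (fun b hb k => homogeneousComponent_mem_ker hzhom hb k) hKv hKw
      · intro a
        rw [LinearMap.mem_ker, LinearMap.mem_ker, hz, hzero]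
        simp
      · intro c
        simp only [LinearMap.mem_ker, hz, hzero]
        constructor
        -- A syzygy `c` of `w` lifts: the corresponding combination of the `u l` lies in `A`, so a
        -- combination of the `v k` cancels it.
        · intro hc
          have := hzB c
          rw [hc, ← hA, hAv] at this
          obtain ⟨a, ha⟩ := this
          exact ⟨-a, by rw [map_neg, ha, neg_add_cancel], hc⟩
        · rintro ⟨_, _, hc⟩
          exact hc

end LinearSyzygies

/-! ### From linear quotients to linear syzygies. -/

section LinearQuotients

variable {K σ : Type*} [Field K]

/-- An ideal as a submodule of the free module of rank one. -/
noncomputable def columnIdeal (I : Ideal (MvPolynomial σ K)) :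
    Submodule (MvPolynomial σ K) (Fin 1 → MvPolynomial σ K) :=
  Submodule.comap (LinearMap.proj 0) I

theorem mem_columnIdeal {I : Ideal (MvPolynomial σ K)} {f : Fin 1 → MvPolynomial σ K} :
    f ∈ columnIdeal I ↔ f 0 ∈ I := Iff.rfl

theorem columnIdeal_bot : columnIdeal (⊥ : Ideal (MvPolynomial σ K)) = ⊥ := by
  refine (Submodule.eq_bot_iff _).2 fun f hf => funext fun i => ?_
  rw [Subsingleton.elim i 0]
  exact hf

/-- Adding to an ideal one form whose colon ideal is generated by linear forms and has
linear syzygies. -/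
theorem HasLinearSyzygies.sup_span_singleton {n s : ℕ} {I V : Ideal (MvPolynomial σ K)}
    {u : MvPolynomial σ K} (hu : u.IsHomogeneous s) (hV : ∀ f, f ∈ V ↔ f * u ∈ I)
    (hI : HasLinearSyzygies (n + 1) (columnIdeal I) s)
    (hVn : HasLinearSyzygies n (columnIdeal V) 1) :
    HasLinearSyzygies (n + 1) (columnIdeal (I ⊔ Ideal.span {u})) s := by
  obtain ⟨r, v, hv, hIv, hK⟩ := hI
  let w : Fin r ⊕ Fin 1 → Fin 1 → MvPolynomial σ K := Sum.elim v fun _ _ => u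
  have hw : ∀ a c, Fintype.linearCombination (MvPolynomial σ K) (w ∘ finSumFinEquiv.symm)
      (Sum.elim a c ∘ finSumFinEquiv.symm) =
      Fintype.linearCombination (MvPolynomial σ K) v a + fun _ => c 0 * u := by
    intro a c
    rw [linearCombination_sumElim]
    funext i
    simp [w, Fintype.linearCombination_apply]
  have hwhom : ∀ a b, ((w ∘ finSumFinEquiv.symm) a b).IsHomogeneous s := by
    intro a b
    rcases h : finSumFinEquiv.symm a with k | k
    · simpa [w, h] using hv k b
    · simpa [w, h] using hu
  have hrange : ∀ f, f ∈ I ↔ ∃ a, Fintype.linearCombination (MvPolynomial σ K) v a =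
      fun _ => f := by
    intro f
    rw [← LinearMap.mem_range, ← hIv, mem_columnIdeal]
  refine ⟨r + 1, w ∘ finSumFinEquiv.symm, hwhom, ?_, ?_⟩
  · ext f
    have hf : (fun _ => f 0) = f := funext fun i => by rw [Subsingleton.elim i 0]
    rw [mem_columnIdeal, Submodule.mem_sup]
    constructor
    · rintro ⟨y, hy, z, hz, hyz⟩
      obtain ⟨c, rfl⟩ := Ideal.mem_span_singleton'.1 hz
      obtain ⟨a, ha⟩ := (hrange y).1 hy
      refine ⟨Sum.elim a (fun _ => c) ∘ finSumFinEquiv.symm, ?_⟩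
      rw [hw, ha, ← hf, ← hyz]
      rfl
    · rintro ⟨q, rfl⟩
      rw [← sumElim_comp_equiv finSumFinEquiv.symm q, hw]
      refine ⟨_, ?_, _, Ideal.mem_span_singleton'.2 ⟨_, rfl⟩, rfl⟩
      rw [← mem_columnIdeal, hIv]
      exact ⟨_, rfl⟩
  -- The last coordinates of syzygies of the enlarged family form the colon ideal `V`; those with
  -- last coordinate zero are the syzygies of `v`.
  · refine HasLinearSyzygies.extension finSumFinEquiv.symm ?_ ?_
      (fun b hb k => homogeneousComponent_mem_ker hwhom hb k) hK hVn
    · intro a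
      rw [LinearMap.mem_ker, LinearMap.mem_ker, hw]
      refine Eq.congr_left ?_
      funext i
      simp
    · intro c
      rw [mem_columnIdeal, hV, ← neg_mem_iff, hrange]
      simp only [LinearMap.mem_ker, hw, add_eq_zero_iff_eq_neg]
      rfl

theorem span_insert_image {α R : Type*} [CommRing R] (f : α → R) (a : α) (S : Set α) :
    Ideal.span (f '' insert a S) = Ideal.span (f '' S) ⊔ Ideal.span {f a} := by
  rw [Set.image_insert_eq, Ideal.span_insert, sup_comm]

/-- Ideals generated by finitely many variables have linear syzygies (the Koszul complex). -/
theorem hasLinearSyzygies_span_X {Y : Set σ} (hY : Y.Finite) :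
    ∃ n, HasLinearSyzygies n
      (columnIdeal (Ideal.span (X '' Y : Set (MvPolynomial σ K)))) 1 := by
  induction Y, hY using Set.Finite.induction_on with
  | empty => exact ⟨0, by simp [HasLinearSyzygies, columnIdeal_bot]⟩
  | @insert y Y hy _ ih =>
    obtain ⟨n, hn⟩ := ih
    refine ⟨n + 1, ?_⟩
    rw [span_insert_image]
    -- A variable outside `Y` is a nonzerodivisor modulo the ideal of `Y`, so the colon ideal is
    -- that ideal again.
    refine HasLinearSyzygies.sup_span_singleton (isHomogeneous_X K y) (fun f => ?_) hn.succ hn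
    refine ⟨fun h => Ideal.mul_mem_right _ _ h, fun h => ?_⟩
    rw [mem_ideal_span_X_image] at h ⊢
    intro m hm
    obtain ⟨i, hi, hmi⟩ := h (m + Finsupp.single y 1) (by
      rw [mem_support_iff, coeff_mul_X]
      exact mem_support_iff.1 hm)
    refine ⟨i, hi, ?_⟩
    rwa [Finsupp.add_apply, Finsupp.single_eq_of_ne (by rintro rfl; exact hy hi),
      add_zero] at hmi

/-- Sets of exponents of monomials that generate an ideal with linear quotients, in some
ordering. -/
inductive HasLinearQuotients : Set (σ →₀ ℕ) → Prop
  | empty : HasLinearQuotients ∅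
  | insert {S : Set (σ →₀ ℕ)} (u : σ →₀ ℕ) : HasLinearQuotients S →
      (∀ a ∈ S, ∃ y, u y < a y ∧ ∃ b ∈ S, b ≤ u + Finsupp.single y 1) →
      HasLinearQuotients (Insert.insert u S)

theorem HasLinearQuotients.finite {S : Set (σ →₀ ℕ)} (h : HasLinearQuotients S) : S.Finite := by
  induction h with
  | empty => exact Set.finite_empty
  | insert u _ _ ih => exact ih.insert u

/-- Each new generator has a colon ideal generated by variables, whose syzygies are linear by
`hasLinearSyzygies_span_X`. -/
theorem HasLinearQuotients.hasLinearSyzygies {S : Set (σ →₀ ℕ)} (h : HasLinearQuotients S)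
    {s : ℕ} (hs : ∀ u ∈ S, u.degree = s) :
    ∃ n, HasLinearSyzygies n
      (columnIdeal (Ideal.span ((fun u => monomial u (1 : K)) '' S))) s := by
  induction h with
  | empty => exact ⟨0, by simp [HasLinearSyzygies, columnIdeal_bot]⟩
  | @insert S u hS hu ih =>
    obtain ⟨n, hn⟩ := ih fun v hv => hs v (Set.mem_insert_of_mem _ hv)
    -- The first condition makes `Y` finite; the second places its variables in the colon ideal.
    let Y : Set σ := {y | (∃ a ∈ S, u y < a y) ∧ ∃ b ∈ S, b ≤ u + Finsupp.single y 1}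
    have hY : Y.Finite := by
      refine (hS.finite.biUnion fun a _ => a.support.finite_toSet).subset ?_
      rintro y ⟨⟨a, ha, hya⟩, -⟩
      exact Set.mem_biUnion ha (Finsupp.mem_support_iff.2 (by omega))
    obtain ⟨k, hk⟩ := hasLinearSyzygies_span_X (K := K) hY
    refine ⟨max n k + 1, ?_⟩
    rw [span_insert_image]
    refine HasLinearSyzygies.sup_span_singleton
      (V := Ideal.span (X '' Y)) (isHomogeneous_monomial _ (hs u (Set.mem_insert _ _)))
      (fun f => ⟨fun h => ?_, fun h => ?_⟩) (hn.mono (by omega)) (hk.mono (by omega))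
    · suffices Submodule.span (MvPolynomial σ K) (X '' Y) ≤ Submodule.comap
          (LinearMap.mulRight (MvPolynomial σ K) (monomial u (1 : K)))
          (Ideal.span ((fun u => monomial u (1 : K)) '' S)) from this h
      rw [Submodule.span_le]
      rintro _ ⟨y, ⟨-, b, hb, hby⟩, rfl⟩
      change X y * monomial u 1 ∈ Ideal.span ((fun u => monomial u (1 : K)) '' S)
      rw [X, monomial_mul, mem_ideal_span_monomial_image, mul_one]
      intro m hm
      rw [Finset.mem_singleton.1 (support_monomial_subset hm), add_comm]
      exact ⟨b, hb, hby⟩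
    -- If `a` divides `m + u` and `u y < a y`, then `y` divides `m`.
    · rw [mem_ideal_span_X_image]
      rw [mem_ideal_span_monomial_image] at h
      intro m hm
      obtain ⟨a, ha, ham⟩ := h (m + u) (by
        rw [mem_support_iff, coeff_mul_monomial, mul_one]
        exact mem_support_iff.1 hm)
      obtain ⟨y, hy, hb⟩ := hu a ha
      refine ⟨y, ⟨⟨a, ha, hy⟩, hb⟩, ?_⟩
      have := ham y
      rw [Finsupp.add_apply] at this
      omega

end LinearQuotients

/-! ### Linear quotients of Ferrer ideals. -/

section Ferrer

/-- Multiplying by a common monomial does not affect colon ideals within `T`, so only comparisons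
with `S` need a hypothesis. -/
theorem HasLinearQuotients.union_add {σ : Type*} {S T : Set (σ →₀ ℕ)} (e : σ →₀ ℕ)
    (hS : HasLinearQuotients S) (hT : HasLinearQuotients T)
    (h : ∀ u ∈ T, ∀ a ∈ S, ∃ y, (e + u) y < a y ∧ ∃ b ∈ S, b ≤ e + u + Finsupp.single y 1) :
    HasLinearQuotients (S ∪ (fun t => e + t) '' T) := by
  induction hT with
  | empty => simpa using hS
  | @insert T u hT hu ih =>
    rw [Set.image_insert_eq, Set.union_insert]
    refine HasLinearQuotients.insert _ (ih fun v hv => h v (Set.mem_insert_of_mem _ hv)) ?_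
    rintro a (ha | ⟨t, ht, rfl⟩)
    · obtain ⟨y, hy, b, hb, hb'⟩ := h u (Set.mem_insert _ _) a ha
      exact ⟨y, hy, b, Or.inl hb, hb'⟩
    · obtain ⟨y, hy, b, hb, hb'⟩ := hu t ht
      refine ⟨y, by simpa using hy, e + b, Or.inr ⟨b, hb, rfl⟩, ?_⟩
      rw [add_assoc]
      exact add_le_add_right hb' e

namespace FerrerArray

variable {σ : Type*} (x : ℕ × ℕ → σ)

/-- The exponents of the monomial generators of the ideal of an array. -/
def exponents : (p : ℕ) → FerrerArray p → Set (σ →₀ ℕ)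
  | 0, _ => ∅
  | 1, l => {u | ∃ j : ℕ, 1 ≤ j ∧ Nat.le j l ∧ u = Finsupp.single (x (1, j)) 1}
  | p + 2, a => {u | ∃ i : Fin a.1, ∃ t ∈ exponents (p + 1) (a.2 i),
      u = Finsupp.single (x (p + 2, (i : ℕ) + 1)) 1 + t}

theorem degree_of_mem_exponents : ∀ (p : ℕ) (a : FerrerArray p), ∀ u ∈ exponents x p a,
    u.degree = p
  | 0, a => a.elim
  | 1, _ => by
    rintro u ⟨j, -, -, rfl⟩
    simp
  | p + 2, a => by
    rintro u ⟨i, t, ht, rfl⟩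
    rw [map_add, degree_of_mem_exponents (p + 1) _ t ht, Finsupp.degree_single]
    omega

theorem exponents_mono : ∀ (p : ℕ) (a b : FerrerArray p), Le p a b →
    exponents x p a ⊆ exponents x p b
  | 0, a, _ => a.elim
  | 1, _, _ => by
    rintro h u ⟨j, hj, hja, rfl⟩
    exact ⟨j, hj, Nat.le_trans hja h, rfl⟩
  | p + 2, a, b => by
    rintro ⟨h, hab⟩ u ⟨i, t, ht, rfl⟩
    exact ⟨Fin.castLE h i, t, exponents_mono (p + 1) _ _ (hab i) ht, rfl⟩

theorem exponents_nonempty : ∀ (p : ℕ) (a : FerrerArray p), IsPartition p a →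
    (exponents x p a).Nonempty
  | 0, a => a.elim
  | 1, _ => fun h => ⟨_, 1, le_rfl, h, rfl⟩
  | p + 2, a => by
    rintro ⟨h, hp, -⟩
    obtain ⟨t, ht⟩ := exponents_nonempty (p + 1) _ (hp ⟨0, h⟩)
    exact ⟨_, ⟨0, h⟩, t, ht, rfl⟩

theorem fst_le_of_mem_vars : ∀ (p : ℕ) (a : FerrerArray p), ∀ v ∈ vars p a, v.1 ≤ p
  | 0, a => a.elim
  | 1, _ => fun _ hv => hv.1.le
  | p + 2, a => by
    rintro v (hv | hv)
    · exact hv.1.le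
    · obtain ⟨i, hi⟩ := Set.mem_iUnion.1 hv
      exact (fst_le_of_mem_vars (p + 1) _ v hi).trans (by omega)

theorem mem_image_vars_of_mem_exponents : ∀ (p : ℕ) (a : FerrerArray p),
    ∀ u ∈ exponents x p a, ∀ y, u y ≠ 0 → y ∈ x '' vars p a
  | 0, a => a.elim
  | 1, _ => by
    rintro u ⟨j, hj, hjl, rfl⟩ y hy
    rw [Finsupp.single_apply_ne_zero] at hy
    exact ⟨(1, j), ⟨rfl, hj, hjl⟩, hy.1.symm⟩
  | p + 2, a => by
    rintro u ⟨i, t, ht, rfl⟩ y hy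
    rw [Finsupp.add_apply] at hy
    by_cases h : t y = 0
    · rw [h, add_zero, Finsupp.single_apply_ne_zero] at hy
      exact ⟨(p + 2, i + 1), Or.inl ⟨rfl, by omega, i.2⟩, hy.1.symm⟩
    · obtain ⟨v, hv, rfl⟩ := mem_image_vars_of_mem_exponents (p + 1) _ t ht y h
      exact ⟨v, Or.inr (Set.mem_iUnion.2 ⟨i, hv⟩), rfl⟩

theorem ideal_eq_span_exponents (K : Type*) [Field K] : ∀ (p : ℕ) (a : FerrerArray p),
    ideal K x p a = Ideal.span ((fun u => monomial u (1 : K)) '' exponents x p a)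
  | 0, a => a.elim
  | 1, _ => by
    rw [ideal]
    congr 1
    ext f
    constructor
    · rintro ⟨j, hj, hjl, rfl⟩
      exact ⟨_, ⟨j, hj, hjl, rfl⟩, rfl⟩
    · rintro ⟨_, ⟨j, hj, hjl, rfl⟩, rfl⟩
      exact ⟨j, hj, hjl, rfl⟩
  | p + 2, a => by
    have hmul : ∀ (y : σ) (t : σ →₀ ℕ), (monomial (Finsupp.single y 1 + t) 1 : MvPolynomial σ K) =
        X y * monomial t 1 := fun y t => by rw [X, monomial_mul, mul_one]
    rw [ideal]
    apply le_antisymm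
    · rw [Ideal.span_le]
      rintro _ ⟨i, y, hy, rfl⟩
      rw [ideal_eq_span_exponents K (p + 1)] at hy
      suffices Submodule.span (MvPolynomial σ K)
          ((fun u => monomial u (1 : K)) '' exponents x (p + 1) (a.2 i)) ≤ Submodule.comap
          (LinearMap.mulLeft (MvPolynomial σ K) (X (x (p + 2, (i : ℕ) + 1))))
          (Ideal.span ((fun u => monomial u (1 : K)) '' exponents x (p + 2) a)) from this hy
      rw [Submodule.span_le]
      rintro _ ⟨t, ht, rfl⟩
      exact Ideal.subset_span ⟨_, ⟨i, t, ht, rfl⟩, hmul _ _⟩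
    · rw [Ideal.span_le]
      rintro _ ⟨_, ⟨i, t, ht, rfl⟩, rfl⟩
      refine Ideal.subset_span ⟨i, monomial t 1, ?_, hmul _ _⟩
      rw [ideal_eq_span_exponents K (p + 1)]
      exact Ideal.subset_span ⟨t, ht, rfl⟩

theorem hasLinearQuotients_exponents_one (l : ℕ) (hx : Set.InjOn x (vars 1 l)) :
    HasLinearQuotients (exponents x 1 l) := by
  induction l with
  | zero =>
    convert HasLinearQuotients.empty
    refine Set.eq_empty_of_forall_notMem ?_
    rintro _ ⟨j, hj, hjl, -⟩
    exact absurd (hj.trans hjl) (by simp)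
  | succ l ih =>
    have hsub : vars 1 l ⊆ vars 1 (l + 1) := fun v hv => ⟨hv.1, hv.2.1, hv.2.2.step⟩
    have hins : exponents x 1 (l + 1) =
        insert (Finsupp.single (x (1, l + 1)) 1) (exponents x 1 l) := by
      ext u
      constructor
      · rintro ⟨j, hj, hjl, rfl⟩
        rcases Nat.le_succ_iff.1 hjl with h | h
        · exact Or.inr ⟨j, hj, h, rfl⟩
        · exact Or.inl (by rw [h])
      · rintro (rfl | ⟨j, hj, hjl, rfl⟩)
        · exact ⟨l + 1, by omega, Nat.le_refl _, rfl⟩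
        · exact ⟨j, hj, hjl.step, rfl⟩
    rw [hins]
    refine HasLinearQuotients.insert _ (ih (hx.mono hsub)) ?_
    rintro _ ⟨j, hj, hjl, rfl⟩
    -- The earlier generator is itself the required colon variable.
    refine ⟨x (1, j), ?_, _, ⟨j, hj, hjl, rfl⟩, le_add_self⟩
    have hne : x (1, j) ≠ x (1, l + 1) := fun h => by
      have := hx ⟨rfl, hj, hjl.step⟩ ⟨rfl, Nat.le_add_left 1 l, Nat.le_refl _⟩ h
      have hjl' : j ≤ l := hjl
      simp only [Prod.mk.injEq, true_and] at this
      omega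
    rw [Finsupp.single_eq_of_ne hne, Finsupp.single_eq_same]
    exact one_pos

theorem hasLinearQuotients_exponents : ∀ (p : ℕ) (a : FerrerArray p), IsPartition p a →
    Set.InjOn x (vars p a) → HasLinearQuotients (exponents x p a)
  | 0, a => a.elim
  | 1, l => fun _ hx => hasLinearQuotients_exponents_one x l hx
  | p + 2, a => by
    rintro ⟨-, hp, hle⟩ hx
    -- The generators coming from the first `k` rows.
    let S : ℕ → Set (σ →₀ ℕ) := fun k => {u | ∃ i : Fin a.1, (i : ℕ) < k ∧
      ∃ t ∈ exponents x (p + 1) (a.2 i), u = Finsupp.single (x (p + 2, (i : ℕ) + 1)) 1 + t}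
    have hS : exponents x (p + 2) a = S a.1 := by
      ext u
      exact ⟨fun ⟨i, t, ht, h⟩ => ⟨i, i.2, t, ht, h⟩, fun ⟨i, _, t, ht, h⟩ => ⟨i, t, ht, h⟩⟩
    suffices ∀ k ≤ a.1, HasLinearQuotients (S k) from hS ▸ this _ le_rfl
    intro k hk
    induction k with
    | zero =>
      convert HasLinearQuotients.empty
      refine Set.eq_empty_of_forall_notMem ?_
      rintro _ ⟨i, hi, -⟩
      exact absurd hi (by simp)
    | succ k ih =>
      have hsucc : S (k + 1) = S k ∪ (fun t => Finsupp.single (x (p + 2, k + 1)) 1 + t) ''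
          exponents x (p + 1) (a.2 ⟨k, hk⟩) := by
        ext u
        constructor
        · rintro ⟨i, hi, t, ht, rfl⟩
          rcases Nat.lt_succ_iff_lt_or_eq.1 hi with h | h
          · exact Or.inl ⟨i, h, t, ht, rfl⟩
          · obtain rfl : i = ⟨k, hk⟩ := Fin.ext h
            exact Or.inr ⟨t, ht, rfl⟩
        · rintro (⟨i, hi, t, ht, rfl⟩ | ⟨t, ht, rfl⟩)
          · exact ⟨i, by omega, t, ht, rfl⟩
          · exact ⟨⟨k, hk⟩, Nat.lt_succ_self k, t, ht, rfl⟩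
      have hvars : ∀ i : Fin a.1, vars (p + 1) (a.2 i) ⊆ vars (p + 2) a :=
        fun i v hv => Or.inr (Set.mem_iUnion.2 ⟨i, hv⟩)
      have hvar : ∀ i : Fin a.1, (p + 2, (i : ℕ) + 1) ∈ vars (p + 2) a :=
        fun i => Or.inl ⟨rfl, by omega, i.2⟩
      rw [hsucc]
      refine HasLinearQuotients.union_add _ (ih (by omega))
        (hasLinearQuotients_exponents (p + 1) _ (hp _) (hx.mono (hvars _))) ?_
      rintro u hu _ ⟨i, hi, t, ht, rfl⟩
      -- The earlier generator used is `x_i u`, not the given `x_i t`; it exists because row `k` is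
      -- contained in row `i`.
      refine ⟨x (p + 2, i + 1), ?_, _, ⟨i, hi, u, ?_, rfl⟩, ?_⟩
      · have hne : x (p + 2, (i : ℕ) + 1) ≠ x (p + 2, k + 1) := fun h => by
          have := hx (hvar i) (hvar ⟨k, hk⟩) h
          simp only [Prod.mk.injEq, true_and] at this
          omega
        -- Monomials of a row involve only variables of level at most `p + 1`.
        have hu0 : u (x (p + 2, (i : ℕ) + 1)) = 0 := by
          by_contra h
          obtain ⟨v, hv, hvx⟩ := mem_image_vars_of_mem_exponents x _ _ u hu _ h
          have := hx (hvars _ hv) (hvar i) hvx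
          have h1 := fst_le_of_mem_vars _ _ v hv
          rw [this] at h1
          simp at h1
        rw [Finsupp.add_apply, Finsupp.add_apply, hu0, Finsupp.single_eq_of_ne hne,
          Finsupp.single_eq_same]
        omega
      · exact exponents_mono x _ _ _ (hle i ⟨k, hk⟩ hi.le) hu
      · rw [add_assoc, add_comm u]
        exact le_add_self

end FerrerArray

end Ferrer

/-! ### Construction and uniqueness of minimal graded free resolutions. -/

section Resolutions

variable {K σ M : Type*} [Field K] [AddCommGroup M] [Module K M] [Module (MvPolynomial σ K) M]

/-- The grading of a submodule of a free module all of whose basis vectors have degree `d`. -/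
def shiftGrading {ι : Type*} (N : Submodule (MvPolynomial σ K) (ι → MvPolynomial σ K))
    (d n : ℕ) : Submodule K N where
  carrier := {k | ∀ b, ∀ m ∈ (k.1 b).support, m.degree + d = n}
  zero_mem' := by simp
  add_mem' := by
    classical
    intro k l hk hl b m hm
    rcases Finset.mem_union.1 (support_add hm) with h | h
    exacts [hk b m h, hl b m h]
  smul_mem' := by
    intro c k hk b m hm
    exact hk b m (support_smul hm)

theorem mem_shiftGrading {ι : Type*} {N : Submodule (MvPolynomial σ K) (ι → MvPolynomial σ K)}
    {d n : ℕ} {k : N} :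
    k ∈ shiftGrading N d n ↔ ∀ b, ∀ m ∈ (k.1 b).support, m.degree + d = n := Iff.rfl

theorem map_linearCombination_eq {R M : Type*} [CommRing R] [AddCommGroup M] [Module R M]
    {r t : ℕ} {f : (Fin r → R) →ₗ[R] M} {g : (Fin t → R) →ₗ[R] M} {v : Fin r → Fin t → R}
    (h : ∀ a, g (v a) = f (Pi.single a 1)) (p : Fin r → R) :
    g (Fintype.linearCombination R v p) = f p := by
  have : g ∘ₗ Fintype.linearCombination R v = f := by
    refine LinearMap.pi_ext' fun a => LinearMap.ext_ring ?_
    simp [h]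
  rw [← this, LinearMap.comp_apply]

namespace GradedFreeResolution

variable {ℳ : ℕ → Submodule K M}

/-- A nonzero constant entry would force equal degrees at its source and target. -/
theorem isMinimal_of_deg_lt (F : GradedFreeResolution (σ := σ) ℳ)
    (h : ∀ i a b, F.deg i b < F.deg (i + 1) a) : F.IsMinimal := by
  intro i a b
  by_contra hne
  have := F.d_homogeneous i a b 0 (mem_support_iff.2 hne)
  have := h i a b
  simp only [map_zero] at *
  omega

/-- A resolution of the kernel of a presentation yields a resolution of the module. -/
noncomputable def cons {r : ℕ} (ε : (Fin r → MvPolynomial σ K) →ₗ[MvPolynomial σ K] M)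
    (hε : Function.Surjective ε) {d : ℕ} (hd : ∀ a, ε (Pi.single a 1) ∈ ℳ d)
    {N : Submodule (MvPolynomial σ K) (Fin r → MvPolynomial σ K)} (hN : ∀ p, p ∈ N ↔ ε p = 0)
    (G : GradedFreeResolution (σ := σ) (shiftGrading N d)) :
    GradedFreeResolution (σ := σ) ℳ where
  rank
    | 0 => r
    | i + 1 => G.rank i
  deg
    | 0 => fun _ => d
    | i + 1 => G.deg i
  d
    | 0 => N.subtype ∘ₗ G.ε
    | i + 1 => G.d i
  ε := ε
  d_homogeneous
    -- Membership in `shiftGrading N d` is exactly the degree condition on matrix entries.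
    | 0 => fun a b => G.ε_homogeneous a b
    | i + 1 => G.d_homogeneous i
  ε_homogeneous := hd
  ε_surjective := hε
  exact_zero := by
    intro p
    rw [← hN]
    constructor
    · intro hp
      obtain ⟨w, hw⟩ := G.ε_surjective ⟨p, hp⟩
      exact ⟨w, congrArg Subtype.val hw⟩
    · rintro ⟨w, rfl⟩
      exact (G.ε w).2
  exact_succ
    | 0 => by
      intro p
      refine Iff.trans ?_ (G.exact_zero p)
      exact Submodule.coe_eq_zero
    | i + 1 => G.exact_succ i

/-- Removing the first step of a resolution leaves a resolution of the first syzygy module. -/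
noncomputable def tail (F : GradedFreeResolution (σ := σ) ℳ) {r : ℕ}
    (ε : (Fin r → MvPolynomial σ K) →ₗ[MvPolynomial σ K] M) {d : ℕ} (hd : ∀ a, F.deg 0 a = d)
    {N : Submodule (MvPolynomial σ K) (Fin r → MvPolynomial σ K)} (hN : ∀ p, p ∈ N ↔ ε p = 0)
    (φ : (Fin (F.rank 0) → MvPolynomial σ K) ≃ₗ[MvPolynomial σ K] (Fin r → MvPolynomial σ K))
    (hφ : ∀ p, ε (φ p) = F.ε p)
    (hφd : ∀ n p, (∀ a, ∀ m ∈ (p a).support, m.degree + d = n) →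
      ∀ b, ∀ m ∈ (φ p b).support, m.degree + d = n) :
    GradedFreeResolution (σ := σ) (shiftGrading N d) where
  rank i := F.rank (i + 1)
  deg i := F.deg (i + 1)
  d i := F.d (i + 1)
  ε := LinearMap.codRestrict N (φ.toLinearMap ∘ₗ F.d 0) fun p => (hN _).2 <|
    (hφ _).trans ((F.exact_zero _).2 ⟨p, rfl⟩)
  d_homogeneous i := F.d_homogeneous (i + 1)
  ε_homogeneous a := by
    refine hφd _ _ fun b m hm => ?_
    rw [← hd b]
    exact F.d_homogeneous 0 a b m hm
  ε_surjective := by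
    rintro ⟨k, hk⟩
    obtain ⟨w, hw⟩ := (F.exact_zero (φ.symm k)).1 <| by
      rw [← hφ, φ.apply_symm_apply]
      exact (hN k).1 hk
    refine ⟨w, Subtype.ext ?_⟩
    simp [hw]
  exact_zero := by
    intro p
    rw [← F.exact_succ 0 p, ← Submodule.coe_eq_zero]
    exact φ.map_eq_zero_iff
  exact_succ i := F.exact_succ (i + 1)

theorem constantCoeff_eq_zero_of_ε_eq_zero {F : GradedFreeResolution (σ := σ) ℳ}
    (hF : F.IsMinimal) {p : Fin (F.rank 0) → MvPolynomial σ K} (hp : F.ε p = 0)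
    (b : Fin (F.rank 0)) : constantCoeff (p b) = 0 := by
  obtain ⟨w, rfl⟩ := (F.exact_zero p).1 hp
  rw [← map_linearCombination_eq (f := F.d 0) (g := LinearMap.id)
    (v := fun a => F.d 0 (Pi.single a 1)) (fun _ => rfl) w]
  simp only [LinearMap.id_apply, Fintype.linearCombination_apply, map_sum, Finset.sum_apply,
    Pi.smul_apply, smul_eq_mul, map_mul]
  exact Finset.sum_eq_zero fun a _ => by rw [hF 0 a b, mul_zero]

end GradedFreeResolution

/-- Two minimal presentations have isomorphic free modules. Here the basis of the second one
is concentrated in degree `d`. -/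
theorem GradedFreeResolution.exists_comparison {ℳ : ℕ → Submodule K M}
    {F : GradedFreeResolution (σ := σ) ℳ} (hF : F.IsMinimal) {r d : ℕ}
    (ε : (Fin r → MvPolynomial σ K) →ₗ[MvPolynomial σ K] M) (hε : Function.Surjective ε)
    (hker : ∀ p, ε p = 0 → ∀ b, constantCoeff (p b) = 0)
    (hlift : ∀ n p, ε p ∈ ℳ n → ∃ q, (∀ b, ∀ m ∈ (q b).support, m.degree + d = n) ∧ ε q = ε p) :
    (∀ a, F.deg 0 a = d) ∧
    ∃ φ : (Fin (F.rank 0) → MvPolynomial σ K) ≃ₗ[MvPolynomial σ K] (Fin r → MvPolynomial σ K),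
      (∀ p, ε (φ p) = F.ε p) ∧ ∀ n p, (∀ a, ∀ m ∈ (p a).support, m.degree + d = n) →
        ∀ b, ∀ m ∈ (φ p b).support, m.degree + d = n := by
  have hα : ∀ a, ∃ q : Fin r → MvPolynomial σ K,
      (∀ b, ∀ m ∈ (q b).support, m.degree + d = F.deg 0 a) ∧ ε q = F.ε (Pi.single a 1) := by
    intro a
    obtain ⟨p, hp⟩ := hε (F.ε (Pi.single a 1))
    rw [← hp]
    exact hlift _ _ (hp ▸ F.ε_homogeneous a)
  choose α hαd hα using hα
  choose β hβ using fun b => F.ε_surjective (ε (Pi.single b 1))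
  -- Reduce both lifts modulo the variables. The composites of `α` and `β` differ from the identity
  -- by elements of the kernels, which have no constant terms; so `A` and `B` are mutually inverse.
  let A : Matrix (Fin (F.rank 0)) (Fin r) K := fun a b => constantCoeff (α a b)
  let B : Matrix (Fin r) (Fin (F.rank 0)) K := fun b a => constantCoeff (β b a)
  have hcoeff : ∀ {R : Type _} {S : Type _} [CommRing R] [CommRing S] (f : R →+* S) {k l : ℕ}
      (v : Fin k → Fin l → R) (p : Fin k → R) (b : Fin l),
      f (Fintype.linearCombination R v p b) = ∑ a, f (p a) * f (v a b) := by
    intros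
    simp [Fintype.linearCombination_apply, Finset.sum_apply]
  have hAB : A * B = 1 := by
    ext a a'
    have h := F.constantCoeff_eq_zero_of_ε_eq_zero hF
      (p := Fintype.linearCombination (MvPolynomial σ K) β (α a) - Pi.single a 1)
      (by rw [map_sub, map_linearCombination_eq hβ, hα, sub_self]) a'
    rw [Pi.sub_apply, map_sub, hcoeff, sub_eq_zero] at h
    rw [Matrix.mul_apply, h, Matrix.one_apply, Pi.single_apply]
    simp only [eq_comm (a := a)]
    split_ifs <;> simp
  have hBA : B * A = 1 := by
    ext b b'
    have h := hker
      (Fintype.linearCombination (MvPolynomial σ K) α (β b) - Pi.single b 1)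
      (by rw [map_sub, map_linearCombination_eq hα, hβ, sub_self]) b'
    rw [Pi.sub_apply, map_sub, hcoeff, sub_eq_zero] at h
    rw [Matrix.mul_apply, h, Matrix.one_apply, Pi.single_apply]
    simp only [eq_comm (a := b)]
    split_ifs <;> simp
  -- A basis vector of degree other than `d` would give a zero row of the invertible matrix `A`.
  have hdeg : ∀ a, F.deg 0 a = d := by
    intro a
    by_contra hne
    have hA : ∀ b, A a b = 0 := by
      intro b
      by_contra h
      have := hαd a b 0 (mem_support_iff.2 h)
      rw [map_zero, zero_add] at this
      exact hne this.symm
    have := congrFun (congrFun hAB a) a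
    rw [Matrix.mul_apply, Matrix.one_apply_eq] at this
    simp [hA] at this
  -- All basis degrees now agree, so the entries of `α` have degree zero.
  have hαC : ∀ a b, α a b = C (A a b) := by
    classical
    intro a b
    ext m
    rw [coeff_C]
    split_ifs with hm
    · rw [← hm]
      rfl
    · by_contra h
      have := hαd a b m (mem_support_iff.2 h)
      rw [hdeg a] at this
      exact hm ((Finsupp.degree_eq_zero_iff m).1 (by omega)).symm
  -- The inverse is built from `B` rather than `β`, whose entries need not be constant.
  refine ⟨hdeg, LinearEquiv.ofLinearMap (Matrix.vecMulLinear (A.map C))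
    (Matrix.vecMulLinear (B.map C)) ?_ ?_, ?_, ?_⟩
  · refine LinearMap.ext fun p => ?_
    simp only [LinearMap.comp_apply, Matrix.vecMulLinear_apply, Matrix.vecMul_vecMul,
      ← Matrix.map_mul, hBA]
    rw [Matrix.map_one _ C_0 C_1, Matrix.vecMul_one, LinearMap.id_apply]
  · refine LinearMap.ext fun p => ?_
    simp only [LinearMap.comp_apply, Matrix.vecMulLinear_apply, Matrix.vecMul_vecMul,
      ← Matrix.map_mul, hAB]
    rw [Matrix.map_one _ C_0 C_1, Matrix.vecMul_one, LinearMap.id_apply]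
  · intro p
    rw [← map_linearCombination_eq hα]
    congr 1
    funext b
    simp [Matrix.vecMul, dotProduct, Fintype.linearCombination_apply, hαC]
  · intro n p hp b m hm
    have hm' : coeff m (∑ a, p a * C (A a b)) ≠ 0 := mem_support_iff.1 hm
    rw [coeff_sum] at hm'
    obtain ⟨a, -, ha⟩ := Finset.exists_ne_zero_of_sum_ne_zero hm'
    rw [mul_comm, coeff_C_mul] at ha
    exact hp a m (mem_support_iff.2 (right_ne_zero_of_mul ha))

/-- This makes a presentation with relation module `N` minimal. -/
theorem HasLinearSyzygies.constantCoeff_eq_zero {n s : ℕ} (hs : 0 < s) {ι : Type}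
    {N : Submodule (MvPolynomial σ K) (ι → MvPolynomial σ K)} (h : HasLinearSyzygies n N s)
    {p : ι → MvPolynomial σ K} (hp : p ∈ N) (b : ι) : constantCoeff (p b) = 0 := by
  obtain ⟨r, v, hv, rfl, -⟩ := h.succ
  obtain ⟨w, rfl⟩ := hp
  simp only [Fintype.linearCombination_apply, Finset.sum_apply, Pi.smul_apply, smul_eq_mul,
    map_sum, map_mul]
  refine Finset.sum_eq_zero fun a _ => ?_
  rw [constantCoeff_eq, (hv a b).coeff_eq_zero (by rw [map_zero]; omega), mul_zero]

/-- The syzygies of a minimal graded free resolution of a module with a presentation by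
generators of degree `d`. -/
theorem GradedFreeResolution.exists_tail {ℳ : ℕ → Submodule K M}
    {F : GradedFreeResolution (σ := σ) ℳ} (hF : F.IsMinimal) {r d n s : ℕ}
    (ε : (Fin r → MvPolynomial σ K) →ₗ[MvPolynomial σ K] M) (hε : Function.Surjective ε)
    (hlift : ∀ n p, ε p ∈ ℳ n → ∃ q, (∀ b, ∀ m ∈ (q b).support, m.degree + d = n) ∧ ε q = ε p)
    {N : Submodule (MvPolynomial σ K) (Fin r → MvPolynomial σ K)} (hN : ∀ p, p ∈ N ↔ ε p = 0)
    (hs : 0 < s) (h : HasLinearSyzygies n N s) :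
    (∀ a, F.deg 0 a = d) ∧ ∃ G : GradedFreeResolution (σ := σ) (shiftGrading N d),
      G.IsMinimal ∧ ∀ i c, (∀ a, G.deg i a = c) → ∀ a, F.deg (i + 1) a = c := by
  obtain ⟨hd, φ, hφ, hφd⟩ := exists_comparison hF ε hε
    (fun p hp => h.constantCoeff_eq_zero hs ((hN p).2 hp)) hlift
  exact ⟨hd, F.tail ε hd hN φ hφ hφd, fun i => hF (i + 1), fun _ _ h => h⟩

/-- The first step is compared with the given generators; the tail then resolves the next syzygy
module, with `d + s` for `d` and `1` for `s`. -/
theorem HasLinearSyzygies.deg_eq (i : ℕ) : ∀ {n d s r : ℕ}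
    {N : Submodule (MvPolynomial σ K) (Fin r → MvPolynomial σ K)} (_ : HasLinearSyzygies n N s)
    {F : GradedFreeResolution (σ := σ) (shiftGrading N d)} (_ : F.IsMinimal)
    (a : Fin (F.rank i)), F.deg i a = d + s + i := by
  induction i with
  | zero =>
    intro n d s r N h F hF
    obtain ⟨t, v, hv, rfl, hK⟩ := h.succ
    refine (F.exists_tail hF (d := d + s) _ (LinearMap.surjective_rangeRestrict _) ?_
      (fun p => ?_) one_pos hK).1
    · intro k p hp
      obtain ⟨q, hq, hqp⟩ := exists_homogeneous_coefficients hv p (mem_shiftGrading.1 hp)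
      exact ⟨q, hq, Subtype.ext hqp⟩
    · rw [← LinearMap.mem_ker, LinearMap.ker_rangeRestrict]
  | succ i ih =>
    intro n d s r N h F hF
    obtain ⟨t, v, hv, rfl, hK⟩ := h.succ
    obtain ⟨-, G, hG, hGF⟩ := F.exists_tail hF (d := d + s) _
      (LinearMap.surjective_rangeRestrict _) (fun k p hp => by
        obtain ⟨q, hq, hqp⟩ := exists_homogeneous_coefficients hv p (mem_shiftGrading.1 hp)
        exact ⟨q, hq, Subtype.ext hqp⟩)
      (fun p => by rw [← LinearMap.mem_ker, LinearMap.ker_rangeRestrict]) one_pos hK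
    refine hGF i _ fun a => ?_
    rw [ih hK hG a]
    omega

theorem HasLinearSyzygies.exists_resolution {n : ℕ} : ∀ {d s r : ℕ}
    {N : Submodule (MvPolynomial σ K) (Fin r → MvPolynomial σ K)} (_ : HasLinearSyzygies n N s),
    ∃ F : GradedFreeResolution (σ := σ) (shiftGrading N d), ∀ i a, F.deg i a = d + s + i := by
  induction n with
  | zero =>
    rintro d s r _ rfl
    exact ⟨
      { rank := fun _ => 0
        deg := fun _ a => a.elim0
        d := fun _ => 0
        ε := 0
        d_homogeneous := fun _ a => a.elim0
        ε_homogeneous := fun a => a.elim0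
        ε_surjective := fun x => ⟨0, Subsingleton.elim _ _⟩
        exact_zero := fun x => ⟨fun _ => ⟨0, Subsingleton.elim _ _⟩, fun _ => rfl⟩
        exact_succ := fun _ x => ⟨fun _ => ⟨0, Subsingleton.elim _ _⟩, fun _ => rfl⟩ },
      fun _ a => a.elim0⟩
  | succ n ih =>
    rintro d s r _ ⟨t, v, hv, rfl, hK⟩
    obtain ⟨G, hG⟩ := ih (d := d + s) hK
    refine ⟨GradedFreeResolution.cons _ (LinearMap.surjective_rangeRestrict _) (d := d + s) ?_
      (fun p => ?_) G, ?_⟩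
    · intro a b m hm
      have h : (Fintype.linearCombination (MvPolynomial σ K) v).rangeRestrict (Pi.single a 1) =
          v a := by simp
      rw [h] at hm
      rw [degree_eq_of_isHomogeneous (hv a b) hm, add_comm]
    · rw [← LinearMap.mem_ker, LinearMap.ker_rangeRestrict]
    · rintro (_ | i) a
      · rfl
      · refine (hG i a).trans ?_
        omega

end Resolutions

/-! ### Regularity and the shape of resolutions from a presentation. -/

section Regularity

variable {K σ M : Type*} [Field K] [AddCommGroup M] [Module K M] [Module (MvPolynomial σ K) M]

/-- The supremum is a maximum. -/
theorem castelnuovoMumfordRegularity_eq {ℳ : ℕ → Submodule K M} {c : ℝ}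
    (hle : ∀ F : GradedFreeResolution (σ := σ) ℳ, F.IsMinimal → ∀ i (a : Fin (F.rank i)),
      (F.deg i a : ℝ) - i ≤ c)
    (hmem : ∃ F : GradedFreeResolution (σ := σ) ℳ, F.IsMinimal ∧ ∃ i, ∃ a : Fin (F.rank i),
      (F.deg i a : ℝ) - i = c) :
    castelnuovoMumfordRegularity σ ℳ = (c : EReal) := by
  refine IsLUB.sSup_eq (IsGreatest.isLUB ⟨?_, ?_⟩)
  · obtain ⟨F, hF, i, a, h⟩ := hmem
    exact ⟨F, hF, i, a, by rw [h]⟩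
  · rintro _ ⟨F, hF, i, a, rfl⟩
    exact EReal.coe_le_coe_iff.2 (hle F hF i a)

variable {ℳ : ℕ → Submodule K M} {n r d s : ℕ}
  {ε : (Fin r → MvPolynomial σ K) →ₗ[MvPolynomial σ K] M}
  {N : Submodule (MvPolynomial σ K) (Fin r → MvPolynomial σ K)}

/-- A module with generators of degree `d` whose relations are generated in degree `d + s` and
have linear syzygies has a minimal graded free resolution of the expected shape. -/
theorem HasLinearSyzygies.exists_minimal_resolution_of_presentation (h : HasLinearSyzygies n N s)
    (hs : 0 < s) (hε : Function.Surjective ε) (hd : ∀ a, ε (Pi.single a 1) ∈ ℳ d)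
    (hN : ∀ p, p ∈ N ↔ ε p = 0) :
    ∃ F : GradedFreeResolution (σ := σ) ℳ, F.IsMinimal ∧ (∀ a, F.deg 0 a = d) ∧
      ∀ i a, F.deg (i + 1) a = d + s + i := by
  obtain ⟨G, hG⟩ := h.exists_resolution (d := d)
  have h0 : ∀ a, (GradedFreeResolution.cons ε hε hd hN G).deg 0 a = d := fun _ => rfl
  have h1 : ∀ i a, (GradedFreeResolution.cons ε hε hd hN G).deg (i + 1) a = d + s + i :=
    fun i a => hG i a
  refine ⟨_, GradedFreeResolution.isMinimal_of_deg_lt _ ?_, h0, h1⟩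
  rintro (_ | i) a b <;> simp only [h0, h1] <;> omega

/-- All minimal graded free resolutions of such a module have the same shape. -/
theorem HasLinearSyzygies.deg_eq_of_presentation (h : HasLinearSyzygies n N s) (hs : 0 < s)
    (hε : Function.Surjective ε) (hN : ∀ p, p ∈ N ↔ ε p = 0)
    (hlift : ∀ n p, ε p ∈ ℳ n → ∃ q, (∀ b, ∀ m ∈ (q b).support, m.degree + d = n) ∧ ε q = ε p)
    {F : GradedFreeResolution (σ := σ) ℳ} (hF : F.IsMinimal) :
    (∀ a, F.deg 0 a = d) ∧ ∀ i a, F.deg (i + 1) a = d + s + i := by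
  obtain ⟨h0, G, hG, hGF⟩ := F.exists_tail hF ε hε hlift hN hs h
  exact ⟨h0, fun i => hGF i _ fun a => h.deg_eq i hG a⟩

theorem GradedFreeResolution.rank_zero_pos [Nontrivial M]
    (F : GradedFreeResolution (σ := σ) ℳ) : 0 < F.rank 0 := by
  obtain ⟨x, hx⟩ := exists_ne (0 : M)
  obtain ⟨p, rfl⟩ := F.ε_surjective x
  by_contra h
  have : IsEmpty (Fin (F.rank 0)) := by
    rw [Nat.eq_zero_of_not_pos h]
    infer_instance
  exact hx (by rw [Subsingleton.elim p 0, map_zero])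

end Regularity

/-! ### Ideals with linear syzygies and their quotients. -/

section LinearIdeals

variable {K σ : Type*} [Field K] {n p : ℕ} {I : Ideal (MvPolynomial σ K)}

/-- The generators of degree `p` present the ideal, with relations generated by linear vectors. -/
theorem HasLinearSyzygies.ideal_resolutions (h : HasLinearSyzygies n (columnIdeal I) p) :
    (∃ F : GradedFreeResolution (σ := σ) (idealGrading I), F.IsMinimal ∧
      ∀ i a, F.deg i a = p + i) ∧
    ∀ F : GradedFreeResolution (σ := σ) (idealGrading I), F.IsMinimal →
      ∀ i a, F.deg i a = p + i := by
  obtain ⟨r, v, hv, hI, hK⟩ := h.succ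
  have hI' : ∀ f : Fin 1 → MvPolynomial σ K, f 0 ∈ I ↔
      f ∈ LinearMap.range (Fintype.linearCombination (MvPolynomial σ K) v) := fun f => by
    rw [← hI, mem_columnIdeal]
  let ε : (Fin r → MvPolynomial σ K) →ₗ[MvPolynomial σ K] I :=
    LinearMap.codRestrict I (LinearMap.proj 0 ∘ₗ Fintype.linearCombination (MvPolynomial σ K) v)
      fun p => (hI' _).2 ⟨p, rfl⟩
  have hε0 : ∀ p, (ε p : MvPolynomial σ K) =
      Fintype.linearCombination (MvPolynomial σ K) v p 0 := fun _ => rfl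
  have hε : Function.Surjective ε := by
    rintro ⟨f, hf⟩
    obtain ⟨q, hq⟩ := (hI' fun _ => f).1 hf
    exact ⟨q, Subtype.ext (congrFun hq 0)⟩
  have hd : ∀ a, ε (Pi.single a 1) ∈ idealGrading I p := by
    intro a
    change (ε (Pi.single a 1) : MvPolynomial σ K) ∈ homogeneousSubmodule σ K p
    rw [hε0, Fintype.linearCombination_apply_single, one_smul]
    exact hv a 0
  have hN : ∀ q, q ∈ LinearMap.ker (Fintype.linearCombination (MvPolynomial σ K) v) ↔
      ε q = 0 := by
    intro q
    rw [LinearMap.mem_ker, ← Submodule.coe_eq_zero, hε0]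
    refine ⟨fun h => congrFun h 0, fun h => funext fun i => ?_⟩
    rw [Subsingleton.elim i 0]
    exact h
  have hlift : ∀ n q, ε q ∈ idealGrading I n →
      ∃ q', (∀ b, ∀ m ∈ (q' b).support, m.degree + p = n) ∧ ε q' = ε q := by
    intro n q hq
    have hq' : (ε q : MvPolynomial σ K).IsHomogeneous n := hq
    obtain ⟨q', h, hqq⟩ := exists_homogeneous_coefficients hv q (d := 0) (n := n)
      fun b m hm => by
        rw [Subsingleton.elim b 0] at hm
        exact degree_eq_of_isHomogeneous hq' hm
    refine ⟨q', by simpa using h, Subtype.ext ?_⟩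
    rw [hε0, hε0, hqq]
  constructor
  · obtain ⟨F, hF, h0, h1⟩ :=
      hK.exists_minimal_resolution_of_presentation one_pos hε hd hN
    refine ⟨F, hF, ?_⟩
    rintro (_ | i) a
    · exact h0 a
    · rw [h1]
      omega
  · intro F hF
    obtain ⟨h0, h1⟩ := hK.deg_eq_of_presentation one_pos hε hN hlift hF
    rintro (_ | i) a
    · exact h0 a
    · rw [h1]
      omega

/-- Here `R` presents the quotient, and the relation module is the ideal itself, generated in degree
`p`. -/
theorem HasLinearSyzygies.quotient_resolutions (h : HasLinearSyzygies n (columnIdeal I) p)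
    (hp : 0 < p) :
    (∃ F : GradedFreeResolution (σ := σ) (quotientGrading I), F.IsMinimal ∧
      (∀ a, F.deg 0 a = 0) ∧ ∀ i a, F.deg (i + 1) a = p + i) ∧
    ∀ F : GradedFreeResolution (σ := σ) (quotientGrading I), F.IsMinimal →
      (∀ a, F.deg 0 a = 0) ∧ ∀ i a, F.deg (i + 1) a = p + i := by
  let ε : (Fin 1 → MvPolynomial σ K) →ₗ[MvPolynomial σ K] MvPolynomial σ K ⧸ I :=
    Submodule.mkQ I ∘ₗ LinearMap.proj 0
  have hε : Function.Surjective ε := by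
    intro y
    obtain ⟨f, rfl⟩ := Submodule.mkQ_surjective I y
    exact ⟨fun _ => f, rfl⟩
  have hd : ∀ a, ε (Pi.single a 1) ∈ quotientGrading I 0 := by
    intro a
    rw [Subsingleton.elim a 0]
    exact ⟨1, isHomogeneous_one σ K, by simp [ε]⟩
  have hN : ∀ q, q ∈ columnIdeal I ↔ ε q = 0 := by
    intro q
    rw [mem_columnIdeal]
    exact (Submodule.Quotient.mk_eq_zero I).symm
  have hlift : ∀ n q, ε q ∈ quotientGrading I n →
      ∃ q', (∀ b, ∀ m ∈ (q' b).support, m.degree + 0 = n) ∧ ε q' = ε q := by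
    rintro n q ⟨f, hf, hfq⟩
    exact ⟨fun _ => f, fun _ m hm => degree_eq_of_isHomogeneous hf hm, hfq⟩
  constructor
  · simpa using h.exists_minimal_resolution_of_presentation hp hε hd hN
  · intro F hF
    simpa using h.deg_eq_of_presentation hp hε hN hlift hF

theorem HasLinearSyzygies.regularity (h : HasLinearSyzygies n (columnIdeal I) p) (hp : 0 < p)
    (hI : I ≠ ⊥) :
    castelnuovoMumfordRegularity σ (idealGrading I) = (p : EReal) ∧
    castelnuovoMumfordRegularity σ (quotientGrading I) + 1 = (p : EReal) ∧
    HasLinearResolution σ (idealGrading I) p := by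
  obtain ⟨⟨F, hF, hFd⟩, hall⟩ := h.ideal_resolutions
  obtain ⟨⟨G, hG, hG0, hG1⟩, hall'⟩ := h.quotient_resolutions hp
  have hne : Nontrivial I := Submodule.nontrivial_iff_ne_bot.2 hI
  have hpos := F.rank_zero_pos
  have hp1 : (1 : ℝ) ≤ p := by exact_mod_cast hp
  refine ⟨?_, ?_, F, hF, hFd⟩
  · rw [castelnuovoMumfordRegularity_eq (c := p)]
    · rfl
    · intro F hF i a
      rw [hall F hF i a]
      push_cast
      linarith
    · exact ⟨F, hF, 0, ⟨0, hpos⟩, by rw [hFd]; simp⟩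
  -- The value `p - 1` is attained in homological degree one, so that module must be nonzero.
  · have hrank : 0 < G.rank 1 := by
      obtain ⟨f, hfI, hf⟩ := Submodule.exists_mem_ne_zero_of_ne_bot hI
      by_contra hr
      have hempty : IsEmpty (Fin (G.rank (0 + 1))) := by
        rw [zero_add, Nat.eq_zero_of_not_pos hr]
        infer_instance
      have hnt : Nontrivial (MvPolynomial σ K ⧸ I) := by
        refine Ideal.Quotient.nontrivial_iff.2 fun htop => ?_
        have h1 : (fun _ => 1 : Fin 1 → MvPolynomial σ K) ∈ columnIdeal I := by
          rw [mem_columnIdeal, htop]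
          trivial
        simpa using h.constantCoeff_eq_zero hp h1 0
      -- Since `f` annihilates the quotient, `f` times a basis vector lies in the kernel of `ε`,
      -- hence in the image of a map that would be zero.
      have hfs : G.ε (f • Pi.single ⟨0, G.rank_zero_pos⟩ 1) = 0 := by
        rw [map_smul]
        obtain ⟨y, hy⟩ := Submodule.mkQ_surjective I (G.ε (Pi.single ⟨0, G.rank_zero_pos⟩ 1))
        rw [← hy, ← map_smul]
        exact (Submodule.Quotient.mk_eq_zero I).2 (Ideal.mul_mem_right _ _ hfI)
      obtain ⟨w, hw⟩ := (G.exact_zero _).1 hfs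
      rw [Subsingleton.elim w 0, map_zero] at hw
      have := congrFun hw ⟨0, G.rank_zero_pos⟩
      simp at this
      exact hf this.symm
    rw [castelnuovoMumfordRegularity_eq (c := p - 1)]
    · rw [← EReal.coe_one, ← EReal.coe_add, sub_add_cancel]
      rfl
    -- Homological degree zero contributes `0`, which is at most `p - 1` because `p ≥ 1`.
    · rintro F hF (_ | i) a
      · rw [(hall' F hF).1]
        simpa using hp1
      · rw [(hall' F hF).2]
        push_cast
        linarith
    · exact ⟨G, hG, 1, ⟨0, hrank⟩, by rw [hG1 0]; simp⟩

end LinearIdeals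

theorem mainTheorem2 {K σ : Type*} [Field K] (p : ℕ) (I : Ideal (MvPolynomial σ K))
    (hI : IsFerrerIdeal p I) :
    castelnuovoMumfordRegularity σ (idealGrading I) = (p : EReal) ∧
    castelnuovoMumfordRegularity σ (quotientGrading I) + 1 = (p : EReal) ∧
    HasLinearResolution σ (idealGrading I) p := by
  obtain ⟨Φ, hΦ, x, hx, rfl⟩ := hI
  rw [FerrerArray.ideal_eq_span_exponents]
  obtain ⟨n, hn⟩ := (FerrerArray.hasLinearQuotients_exponents x p Φ hΦ hx).hasLinearSyzygies
    (K := K) (FerrerArray.degree_of_mem_exponents x p Φ)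
  refine hn.regularity ?_ ?_
  · rcases p with _ | p
    · exact hΦ.elim
    · exact p.succ_pos
  · obtain ⟨u, hu⟩ := FerrerArray.exponents_nonempty x p Φ hΦ
    intro hbot
    have : monomial u (1 : K) ∈ (⊥ : Ideal (MvPolynomial σ K)) :=
      hbot ▸ Ideal.subset_span ⟨u, hu, rfl⟩
    simp at this
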